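/- Let $\mathcal A$ be a set of atomic types. The m-types are given by $A ::= \alpha \mid \alpha^{\bot} \mid A\wedge A \mid A\vee A$ with $\alpha\in\mathcal A$, and the types by $C ::= A \mid \bot$. Negation of m-types is defined by $(\alpha)^{\bot}=\alpha^{\bot}$, $(\alpha^{\bot})^{\bot}=\alpha$, $(A\wedge B)^{\bot}=A^{\bot}\vee B^{\bot}$, $(A\vee B)^{\bot}=A^{\bot}\wedge B^{\bot}$. Terms, taken up to renaming of bound variables, are given by $P ::= x \mid \langle P,P\rangle \mid \sigma_1(P)\mid\sigma_2(P)\mid \lambda x\,P \mid (P\star P)$. A context $\Gamma$ is a finite set of declarations $x:A$ of distinct variables with m-types $A$, and the typing relation $\Gamma\vdash P:C$ is generated by the following rules (where $A,A_1,A_2$ are m-types and $i\in\{1,2\}$): * $\Gamma,x:A\vdash x:A$; * if $\Gamma\vdash P_1:A_1$ and $\Gamma\vdash P_2:A_2$, then $\Gamma\vdash\langle P_1,P_2\rangle:A_1\wedge A_2$; * if $\Gamma\vdash P:A_i$, then $\Gamma\vdash\sigma_i(P):A_1\vee A_2$; * if $\Gamma,x:A\vdash P:\bot$, then $\Gamma\vdash\lambda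 x\,P:A^{\bot}$; * if $\Gamma\vdash P_1:A^{\bot}$ and $\Gamma\vdash P_2:A$, then $\Gamma\vdash(P_1\star P_2):\bot$. Let $\rightarrow_{\beta\pi}$ be the compatible closure (closure under all term constructors) of the rules $$(\beta)\ (\lambda x P\star Q)\rightarrow P[x:=Q],\qquad (\beta^{\bot})\ (Q\star\lambda xP)\rightarrow P[x:=Q],$$ $$(\pi)\ (\langle P_1,P_2\rangle\star\sigma_i(Q))\rightarrow (P_i\star Q),\qquad (\pi^{\bot})\ (\sigma_i(Q)\star\langle P_1,P_2\rangle)\rightarrow(Q\star P_i)\qquad (i\in\{1,2\}).$$ **Theorem.** The typed $\lambda_{\beta\pi}$-calculus is strongly normalizing: if $\Gamma\vdash M:C$ for some context $\Gamma$ and some type $C$, then every $\rightarrow_{\beta\pi}$-reduction sequence starting from $M$ is finite. -/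

import Mathlib

namespace LambdaSym

universe u

/-- The m-types over a set `α` of atomic types: atomic types, negated atomic types,
conjunctions and disjunctions. -/
inductive MType (α : Type u) : Type u
  | atom (a : α) : MType α
  | natom (a : α) : MType α
  | and (A B : MType α) : MType α
  | or (A B : MType α) : MType α

/-- The (involutive) negation of an m-type. -/
def MType.neg {α : Type u} : MType α → MType α
  | .atom a => .natom a
  | .natom a => .atom a
  | .and A B => .or A.neg B.neg
  | .or A B => .and A.neg B.neg

/-- The types: the m-types, and the further type `⊥`. -/
inductive Ty (α : Type u) : Type u
  | m (A : MType α) : Ty α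
  | bot : Ty α

/-- The raw terms, up to renaming of bound variables (de Bruijn indices):
variables, `⟨P, Q⟩`, `σ₁(P)`, `σ₂(P)`, `λ x P` and `(P ⋆ Q)`. -/
inductive Term : Type
  | var (n : ℕ) : Term
  | pair (P Q : Term) : Term
  | inj₁ (P : Term) : Term
  | inj₂ (P : Term) : Term
  | lam (P : Term) : Term
  | star (P Q : Term) : Term

namespace Term

/-- Extension of a renaming under a binder. -/
def upRen (ξ : ℕ → ℕ) : ℕ → ℕ
  | 0 => 0
  | n + 1 => ξ n + 1

/-- Renaming of free variables. -/
def rename : (ℕ → ℕ) → Term → Term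
  | ξ, var n => var (ξ n)
  | ξ, pair P Q => pair (rename ξ P) (rename ξ Q)
  | ξ, inj₁ P => inj₁ (rename ξ P)
  | ξ, inj₂ P => inj₂ (rename ξ P)
  | ξ, lam P => lam (rename (upRen ξ) P)
  | ξ, star P Q => star (rename ξ P) (rename ξ Q)

/-- Extension of a simultaneous substitution under a binder. -/
def up (s : ℕ → Term) : ℕ → Term
  | 0 => var 0
  | n + 1 => rename Nat.succ (s n)

/-- Capture-avoiding simultaneous substitution. -/
def subst : (ℕ → Term) → Term → Term
  | s, var n => s n
  | s, pair P Q => pair (subst s P) (subst s Q)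
  | s, inj₁ P => inj₁ (subst s P)
  | s, inj₂ P => inj₂ (subst s P)
  | s, lam P => lam (subst (up s) P)
  | s, star P Q => star (subst s P) (subst s Q)

/-- The substitution that replaces the variable `0` by `Q` and lowers all other variables. -/
def single (Q : Term) : ℕ → Term
  | 0 => Q
  | n + 1 => var n

/-- `P[x := Q]`, where `x` is the variable bound by the `λ` in `λ x P`. -/
def inst (P Q : Term) : Term := subst (single Q) P

end Term

/-- The typing relation `Γ ⊢ M : C`. A context is a list of m-types: its `n`-th entry is the
type declared for the variable with index `n`. -/
inductive HasType {α : Type u} : List (MType α) → Term → Ty α → Prop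
  | var {Γ : List (MType α)} {n : ℕ} {A : MType α} :
      Γ[n]? = some A → HasType Γ (.var n) (.m A)
  | pair {Γ : List (MType α)} {P₁ P₂ : Term} {A₁ A₂ : MType α} :
      HasType Γ P₁ (.m A₁) → HasType Γ P₂ (.m A₂) →
      HasType Γ (.pair P₁ P₂) (.m (.and A₁ A₂))
  | inj₁ {Γ : List (MType α)} {P : Term} {A₁ A₂ : MType α} :
      HasType Γ P (.m A₁) → HasType Γ (.inj₁ P) (.m (.or A₁ A₂))
  | inj₂ {Γ : List (MType α)} {P : Term} {A₁ A₂ : MType α} :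
      HasType Γ P (.m A₂) → HasType Γ (.inj₂ P) (.m (.or A₁ A₂))
  | lam {Γ : List (MType α)} {P : Term} {A : MType α} :
      HasType (A :: Γ) P .bot → HasType Γ (.lam P) (.m A.neg)
  | star {Γ : List (MType α)} {P₁ P₂ : Term} {A : MType α} :
      HasType Γ P₁ (.m A.neg) → HasType Γ P₂ (.m A) → HasType Γ (.star P₁ P₂) .bot

/-- The reduction rules `β`, `β^⊥`, `π` and `π^⊥`, applied at the root of a term. -/
inductive Rule : Term → Term → Prop
  | beta (P Q : Term) : Rule (.star (.lam P) Q) (P.inst Q)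
  | betaPerp (P Q : Term) : Rule (.star Q (.lam P)) (P.inst Q)
  | pi₁ (P₁ P₂ Q : Term) : Rule (.star (.pair P₁ P₂) (.inj₁ Q)) (.star P₁ Q)
  | pi₂ (P₁ P₂ Q : Term) : Rule (.star (.pair P₁ P₂) (.inj₂ Q)) (.star P₂ Q)
  | piPerp₁ (P₁ P₂ Q : Term) : Rule (.star (.inj₁ Q) (.pair P₁ P₂)) (.star Q P₁)
  | piPerp₂ (P₁ P₂ Q : Term) : Rule (.star (.inj₂ Q) (.pair P₁ P₂)) (.star Q P₂)

/-- One-step reduction of the `λ_{βπ}`-calculus: the compatible closure of the rules. -/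
inductive Step : Term → Term → Prop
  | rule {M N : Term} : Rule M N → Step M N
  | pairLeft {P P' : Term} (Q : Term) : Step P P' → Step (.pair P Q) (.pair P' Q)
  | pairRight (P : Term) {Q Q' : Term} : Step Q Q' → Step (.pair P Q) (.pair P Q')
  | inj₁ {P P' : Term} : Step P P' → Step (.inj₁ P) (.inj₁ P')
  | inj₂ {P P' : Term} : Step P P' → Step (.inj₂ P) (.inj₂ P')
  | lam {P P' : Term} : Step P P' → Step (.lam P) (.lam P')
  | starLeft {P P' : Term} (Q : Term) : Step P P' → Step (.star P Q) (.star P' Q)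
  | starRight (P : Term) {Q Q' : Term} : Step Q Q' → Step (.star P Q) (.star P Q')

/-- `M` is strongly normalizable: every reduction sequence starting from `M` is finite. -/
def StronglyNormalizable (M : Term) : Prop :=
  ¬ ∃ f : ℕ → Term, f 0 = M ∧ ∀ n, Step (f n) (f (n + 1))

end LambdaSym

namespace LambdaSym

universe v

namespace Term

/-! ### Substitution calculus -/

/-! The proof uses symmetric reducibility candidates. Since both sides of a cut may be abstractions,
the candidates for `A` and for its negation depend on each other: an abstraction belongs to one when
its instances by elements of the other are strongly normalizing. The dependence is antitone in each
direction, so the composite is monotone, and Knaster-Tarski yields a mutually closed pair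
(`fixPair`).

The two halves of such a pair are orthogonal (`sn_star_of_close`): a β-reduct is controlled by the
fixed-point equations, a π-reduct by orthogonality at the component types. Adequacy
(`HasType.subst_mem_sem`), applied to the identity substitution, gives the theorem. -/

theorem up_var : up var = var := by
  funext n; cases n <;> rfl

theorem subst_var (M : Term) : subst var M = M := by
  induction M <;> simp_all [subst, up_var]

theorem up_comp_upRen (s : ℕ → Term) (ξ : ℕ → ℕ) : up s ∘ upRen ξ = up (s ∘ ξ) := by
  funext n; cases n <;> rfl

theorem subst_rename (M : Term) (s : ℕ → Term) (ξ : ℕ → ℕ) :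
    subst s (rename ξ M) = subst (s ∘ ξ) M := by
  induction M generalizing s ξ <;> simp_all [subst, rename, up_comp_upRen]

theorem upRen_comp (ξ ζ : ℕ → ℕ) : upRen ξ ∘ upRen ζ = upRen (ξ ∘ ζ) := by
  funext n; cases n <;> rfl

theorem rename_rename (M : Term) (ξ ζ : ℕ → ℕ) :
    rename ξ (rename ζ M) = rename (ξ ∘ ζ) M := by
  induction M generalizing ξ ζ <;> simp_all [rename, upRen_comp]

theorem rename_comp_up (ξ : ℕ → ℕ) (s : ℕ → Term) :
    rename (upRen ξ) ∘ up s = up (rename ξ ∘ s) := by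
  funext n
  cases n
  · rfl
  · simp only [Function.comp_apply, up, rename_rename]
    rfl

theorem rename_subst (M : Term) (ξ : ℕ → ℕ) (s : ℕ → Term) :
    rename ξ (subst s M) = subst (rename ξ ∘ s) M := by
  induction M generalizing ξ s <;> simp_all [subst, rename, rename_comp_up]

theorem subst_comp_up (t s : ℕ → Term) : subst (up t) ∘ up s = up (subst t ∘ s) := by
  funext n
  cases n
  · rfl
  · simp only [Function.comp_apply, up, subst_rename, rename_subst]
    rfl

theorem subst_subst (M : Term) (t s : ℕ → Term) :
    subst t (subst s M) = subst (subst t ∘ s) M := by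
  induction M generalizing t s <;> simp_all [subst, subst_comp_up]

/-- Extension of a simultaneous substitution by a term for the variable `0`. -/
def cons (Q : Term) (s : ℕ → Term) : ℕ → Term
  | 0 => Q
  | n + 1 => s n

/-- Lets the induction hypothesis on the body of an abstraction apply to its instances. -/
theorem inst_subst_up (P Q : Term) (s : ℕ → Term) :
    (subst (up s) P).inst Q = subst (cons Q s) P := by
  rw [inst, subst_subst]
  congr 1
  funext n
  cases n
  · rfl
  · simp only [Function.comp_apply, up, subst_rename, cons]
    exact subst_var _

theorem subst_inst (P Q : Term) (s : ℕ → Term) :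
    subst s (P.inst Q) = (subst (up s) P).inst (subst s Q) := by
  rw [inst_subst_up, inst, subst_subst]
  congr 1
  funext n
  cases n <;> rfl

end Term

open Term

/-! ### Reduction and strong normalization -/

theorem Rule.subst {M N : Term} (h : Rule M N) (s : ℕ → Term) :
    Rule (M.subst s) (N.subst s) := by
  cases h <;> simp only [Term.subst, subst_inst] <;> constructor

theorem Step.subst {M N : Term} (h : Step M N) (s : ℕ → Term) :
    Step (M.subst s) (N.subst s) := by
  induction h generalizing s with
  | rule h => exact .rule (h.subst s)
  | pairLeft _ _ ih => exact .pairLeft _ (ih s)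
  | pairRight _ _ ih => exact .pairRight _ (ih s)
  | inj₁ _ ih => exact .inj₁ (ih s)
  | inj₂ _ ih => exact .inj₂ (ih s)
  | lam _ ih => exact .lam (ih _)
  | starLeft _ _ ih => exact .starLeft _ (ih s)
  | starRight _ _ ih => exact .starRight _ (ih s)

/-- Accessibility for the converse of one-step reduction. -/
def SN (M : Term) : Prop := Acc (fun N M => Step M N) M

theorem SN.of_step {M : Term} (h : ∀ N, Step M N → SN N) : SN M := Acc.intro _ h

theorem SN.step {M N : Term} (h : SN M) (hMN : Step M N) : SN N := Acc.inv h hMN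

theorem SN.stronglyNormalizable {M : Term} (h : SN M) : StronglyNormalizable M := by
  induction h with
  | intro M _ ih =>
    rintro ⟨f, rfl, hf⟩
    exact ih _ (hf 0) ⟨fun n => f (n + 1), rfl, fun n => hf (n + 1)⟩

theorem SN.of_map {F : Term → Term} (hF : ∀ {P P'}, Step P P' → Step (F P) (F P')) {P : Term}
    (h : SN (F P)) : SN P := by
  generalize hM : F P = M at h
  induction h generalizing P with
  | intro M _ ih =>
    subst hM
    exact .of_step fun P' hP => ih _ (hF hP) rfl

theorem SN.var (n : ℕ) : SN (.var n) :=
  .of_step fun N h => by cases h with | rule h => cases h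

theorem SN.lam {P : Term} (h : SN P) : SN (.lam P) := by
  induction h with
  | intro P _ ih =>
    refine .of_step fun N hN => ?_
    cases hN with
    | rule h => cases h
    | lam h => exact ih _ h

theorem SN.inj₁ {P : Term} (h : SN P) : SN (.inj₁ P) := by
  induction h with
  | intro P _ ih =>
    refine .of_step fun N hN => ?_
    cases hN with
    | rule h => cases h
    | inj₁ h => exact ih _ h

theorem SN.inj₂ {P : Term} (h : SN P) : SN (.inj₂ P) := by
  induction h with
  | intro P _ ih =>
    refine .of_step fun N hN => ?_
    cases hN with
    | rule h => cases h
    | inj₂ h => exact ih _ h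

theorem SN.pair {P Q : Term} (hP : SN P) (hQ : SN Q) : SN (.pair P Q) := by
  induction hP generalizing Q with
  | intro P _ ihP =>
    induction hQ with
    | intro Q hQ ihQ =>
      refine .of_step fun N hN => ?_
      cases hN with
      | rule h => cases h
      | pairLeft _ h => exact ihP _ h (Acc.intro _ hQ)
      | pairRight _ h => exact ihQ _ h

/-! ### Symmetric reducibility candidates -/

/-- The abstractions all of whose instances by elements of `X` are strongly normalizing. -/
def lamSet (X : Set Term) : Set Term := {M | ∃ P, M = .lam P ∧ ∀ Q ∈ X, SN (P.inst Q)}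

theorem lamSet_antitone : Antitone lamSet := by
  rintro X Y h M ⟨P, rfl, hP⟩
  exact ⟨P, rfl, fun Q hQ => hP Q (h hQ)⟩

/-- The variables, the elements of `B`, and the abstractions in `lamSet X`. -/
def close (B X : Set Term) : Set Term := Set.range Term.var ∪ B ∪ lamSet X

theorem close_antitone (B : Set Term) : Antitone (close B) :=
  fun _ _ h => Set.union_subset_union_right _ (lamSet_antitone h)

/-- The monotone operator whose least fixed point is the first half of a candidate pair. -/
def closeClose (B C : Set Term) : Set Term →o Set Term where
  toFun X := close B (close C X)
  monotone' _ _ h := close_antitone B (close_antitone C h)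

/-- A pair `(X, Y)` with `X = close B Y` and `Y = close C X`. -/
def fixPair (B C : Set Term) : Set Term × Set Term :=
  ((closeClose B C).lfp, close C (closeClose B C).lfp)

theorem fixPair_fst (B C : Set Term) : (fixPair B C).1 = close B (fixPair B C).2 :=
  (closeClose B C).map_lfp.symm

theorem fixPair_snd (B C : Set Term) : (fixPair B C).2 = close C (fixPair B C).1 := rfl

/-- A set of strongly normalizing terms that is closed under reduction. -/
structure Stable (X : Set Term) : Prop where
  sn : ∀ M ∈ X, SN M
  step : ∀ M ∈ X, ∀ N, Step M N → N ∈ X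

theorem Stable.close {B X : Set Term} (hB : Stable B) (hX : ∀ n, Term.var n ∈ X) :
    Stable (close B X) where
  sn := by
    rintro M ((⟨n, rfl⟩ | hM) | ⟨P, rfl, hP⟩)
    · exact .var n
    · exact hB.sn M hM
    -- Reductions of the body persist under instantiation, and a variable is always an available
    -- argument; this is why `close` includes the variables.
    · exact (SN.of_map (F := fun P => P.inst (.var 0)) (fun h => h.subst _) (hP _ (hX 0))).lam
  step := by
    rintro M ((⟨n, rfl⟩ | hM) | ⟨P, rfl, hP⟩) N hN
    · cases hN with | rule h => cases h
    · exact .inl (.inr (hB.step M hM N hN))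
    · cases hN with
      | rule h => cases h
      | lam h => exact .inr ⟨_, rfl, fun Q hQ => (hP Q hQ).step (h.subst _)⟩

/-- Elements of `X` and `Y` may be cut against each other in either order. -/
def Orthogonal (X Y : Set Term) : Prop :=
  ∀ P ∈ X, ∀ Q ∈ Y, SN (.star P Q) ∧ SN (.star Q P)

theorem Orthogonal.symm {X Y : Set Term} (h : Orthogonal X Y) : Orthogonal Y X :=
  fun P hP Q hQ => (h Q hQ P hP).symm

/-- The properties of the interpretations of a type and of its negation. -/
structure Candidates (p : Set Term × Set Term) : Prop where
  var_fst : ∀ n, Term.var n ∈ p.1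
  var_snd : ∀ n, Term.var n ∈ p.2
  lam_fst : lamSet p.2 ⊆ p.1
  lam_snd : lamSet p.1 ⊆ p.2
  stable_fst : Stable p.1
  stable_snd : Stable p.2
  orthogonal : Orthogonal p.1 p.2

theorem Candidates.swap {p : Set Term × Set Term} (h : Candidates p) : Candidates p.swap :=
  ⟨h.var_snd, h.var_fst, h.lam_snd, h.lam_fst, h.stable_snd, h.stable_fst, h.orthogonal.symm⟩

/-- The pairs `⟨P, Q⟩` with components in `X` and `Y`. -/
def pairSet (X Y : Set Term) : Set Term := Set.image2 Term.pair X Y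

/-- The injections `σ₁(P)` with `P` in `X` and `σ₂(Q)` with `Q` in `Y`. -/
def injSet (X Y : Set Term) : Set Term := Term.inj₁ '' X ∪ Term.inj₂ '' Y

theorem Stable.pairSet {X Y : Set Term} (hX : Stable X) (hY : Stable Y) :
    Stable (pairSet X Y) where
  sn := by
    rintro _ ⟨P, hP, Q, hQ, rfl⟩
    exact (hX.sn P hP).pair (hY.sn Q hQ)
  step := by
    rintro _ ⟨P, hP, Q, hQ, rfl⟩ N hN
    cases hN with
    | rule h => cases h
    | pairLeft _ h => exact ⟨_, hX.step P hP _ h, Q, hQ, rfl⟩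
    | pairRight _ h => exact ⟨P, hP, _, hY.step Q hQ _ h, rfl⟩

theorem Stable.injSet {X Y : Set Term} (hX : Stable X) (hY : Stable Y) :
    Stable (injSet X Y) where
  sn := by
    rintro _ (⟨P, hP, rfl⟩ | ⟨P, hP, rfl⟩)
    · exact (hX.sn P hP).inj₁
    · exact (hY.sn P hP).inj₂
  step := by
    rintro _ (⟨P, hP, rfl⟩ | ⟨P, hP, rfl⟩) N hN
    · cases hN with
      | rule h => cases h
      | inj₁ h => exact .inl ⟨_, hX.step P hP _ h, rfl⟩
    · cases hN with
      | rule h => cases h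
      | inj₂ h => exact .inr ⟨_, hY.step P hP _ h, rfl⟩

theorem Stable.empty : Stable ∅ := ⟨fun _ h => h.elim, fun _ h => h.elim⟩

theorem inst_sn_of_lam_mem_close {B X : Set Term} (hB : ∀ P, Term.lam P ∉ B) {P : Term}
    (h : Term.lam P ∈ close B X) {Q : Term} (hQ : Q ∈ X) : SN (P.inst Q) := by
  rcases h with (⟨n, h⟩ | h) | ⟨P', h, hP'⟩
  · cases h
  · exact (hB P h).elim
  · cases h
    exact hP' Q hQ

theorem pair_mem_of_mem_close {B X : Set Term} {P Q : Term} (h : Term.pair P Q ∈ close B X) :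
    Term.pair P Q ∈ B := by
  rcases h with (⟨n, h⟩ | h) | ⟨P', h, -⟩
  · cases h
  · exact h
  · cases h

theorem inj₁_mem_of_mem_close {B X : Set Term} {P : Term} (h : Term.inj₁ P ∈ close B X) :
    Term.inj₁ P ∈ B := by
  rcases h with (⟨n, h⟩ | h) | ⟨P', h, -⟩
  · cases h
  · exact h
  · cases h

theorem inj₂_mem_of_mem_close {B X : Set Term} {P : Term} (h : Term.inj₂ P ∈ close B X) :
    Term.inj₂ P ∈ B := by
  rcases h with (⟨n, h⟩ | h) | ⟨P', h, -⟩
  · cases h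
  · exact h
  · cases h

/-- Every root reduct of a cut between `B` and `C` is strongly normalizing. -/
def CutRules (B C : Set Term) : Prop :=
  ∀ P ∈ B, ∀ Q ∈ C, ∀ N, Rule (.star P Q) N → SN N

/-- Nested induction on the strong normalization of `P` and `Q`; stability handles inner steps. As
`B` and `C` contain no abstraction, one lying in `X` or `Y` must come from `lamSet`, which settles
both β rules. -/
theorem sn_star_of_close {B C X Y : Set Term} (hX : X = close B Y) (hY : Y = close C X)
    (sX : Stable X) (sY : Stable Y) (hB : ∀ P, Term.lam P ∉ B) (hC : ∀ P, Term.lam P ∉ C)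
    (hBC : CutRules B C) {P Q : Term} (hP : P ∈ X) (hQ : Q ∈ Y) : SN (.star P Q) := by
  have snP := sX.sn P hP
  have snQ := sY.sn Q hQ
  induction snP generalizing Q with
  | intro P aP ihP =>
    induction snQ with
    | intro Q aQ ihQ =>
      refine .of_step fun N hN => ?_
      cases hN with
      | starLeft _ h => exact ihP _ h (sX.step P hP _ h) hQ (Acc.intro _ aQ)
      | starRight _ h => exact ihQ _ h (sY.step Q hQ _ h)
      | rule h =>
        have hP' := hX ▸ hP
        have hQ' := hY ▸ hQ
        have hr := h
        cases h with
        | beta => exact inst_sn_of_lam_mem_close hB hP' hQ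
        | betaPerp => exact inst_sn_of_lam_mem_close hC hQ' hP
        | pi₁ => exact hBC _ (pair_mem_of_mem_close hP') _ (inj₁_mem_of_mem_close hQ') _ hr
        | pi₂ => exact hBC _ (pair_mem_of_mem_close hP') _ (inj₂_mem_of_mem_close hQ') _ hr
        | piPerp₁ => exact hBC _ (inj₁_mem_of_mem_close hP') _ (pair_mem_of_mem_close hQ') _ hr
        | piPerp₂ => exact hBC _ (inj₂_mem_of_mem_close hP') _ (pair_mem_of_mem_close hQ') _ hr

theorem candidates_fixPair {B C : Set Term} (sB : Stable B) (sC : Stable C)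
    (hB : ∀ P, Term.lam P ∉ B) (hC : ∀ P, Term.lam P ∉ C) (hBC : CutRules B C)
    (hCB : CutRules C B) : Candidates (fixPair B C) := by
  have h₁ := fixPair_fst B C
  have h₂ := fixPair_snd B C
  have v₁ : ∀ n, Term.var n ∈ (fixPair B C).1 := fun n => h₁ ▸ .inl (.inl ⟨n, rfl⟩)
  have v₂ : ∀ n, Term.var n ∈ (fixPair B C).2 := fun n => h₂ ▸ .inl (.inl ⟨n, rfl⟩)
  have s₁ : Stable (fixPair B C).1 := h₁ ▸ sB.close v₂
  have s₂ : Stable (fixPair B C).2 := h₂ ▸ sC.close v₁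
  refine ⟨v₁, v₂, fun M hM => h₁ ▸ .inr hM, fun M hM => h₂ ▸ .inr hM, s₁, s₂, ?_⟩
  exact fun P hP Q hQ => ⟨sn_star_of_close h₁ h₂ s₁ s₂ hB hC hBC hP hQ,
    sn_star_of_close h₂ h₁ s₂ s₁ hC hB hCB hQ hP⟩

theorem candidates_fixPair_empty : Candidates (fixPair ∅ ∅) :=
  candidates_fixPair .empty .empty (fun _ h => h) (fun _ h => h) (fun _ h => h.elim)
    (fun _ h => h.elim)

theorem candidates_fixPair_pairSet_injSet {p q : Set Term × Set Term} (hp : Candidates p)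
    (hq : Candidates q) : Candidates (fixPair (pairSet p.1 q.1) (injSet p.2 q.2)) := by
  refine candidates_fixPair (hp.stable_fst.pairSet hq.stable_fst)
    (hp.stable_snd.injSet hq.stable_snd) ?_ ?_ ?_ ?_
  · rintro P ⟨_, _, _, _, h⟩
    cases h
  · rintro P (⟨_, _, h⟩ | ⟨_, _, h⟩) <;> cases h
  · rintro _ ⟨P, hP, Q, hQ, rfl⟩ _ (⟨R, hR, rfl⟩ | ⟨R, hR, rfl⟩) N h <;> cases h
    · exact (hp.orthogonal P hP R hR).1
    · exact (hq.orthogonal Q hQ R hR).1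
  · rintro _ (⟨R, hR, rfl⟩ | ⟨R, hR, rfl⟩) _ ⟨P, hP, Q, hQ, rfl⟩ N h <;> cases h
    · exact (hp.orthogonal P hP R hR).2
    · exact (hq.orthogonal Q hQ R hR).2

/-! ### Interpretation of types and soundness -/

variable {α : Type v}

/-- The interpretation of an m-type, together with that of its negation. -/
def MType.sem : MType α → Set Term × Set Term
  | .atom _ => fixPair ∅ ∅
  | .natom _ => (fixPair ∅ ∅).swap
  | .and A B => fixPair (pairSet A.sem.1 B.sem.1) (injSet A.sem.2 B.sem.2)
  | .or A B => (fixPair (pairSet A.sem.2 B.sem.2) (injSet A.sem.1 B.sem.1)).swap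

/-- Holds because `natom` and `or` are interpreted by swapping the pair of their dual. Building them
with `fixPair` afresh could fail, since its first half is a least fixed point and the construction
is not symmetric. -/
theorem MType.sem_neg (A : MType α) : A.neg.sem = A.sem.swap := by
  induction A <;> simp_all [MType.neg, MType.sem]

theorem MType.candidates_sem (A : MType α) : Candidates A.sem := by
  induction A with
  | atom => exact candidates_fixPair_empty
  | natom => exact candidates_fixPair_empty.swap
  | and A B hA hB => exact candidates_fixPair_pairSet_injSet hA hB
  | or A B hA hB => exact (candidates_fixPair_pairSet_injSet hA.swap hB.swap).swap

/-- The interpretation of a type. -/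
def Ty.sem : Ty α → Set Term
  | .m A => A.sem.1
  | .bot => {M | SN M}

theorem Ty.sn_of_mem_sem {C : Ty α} {M : Term} (h : M ∈ C.sem) : SN M := by
  cases C with
  | m A => exact A.candidates_sem.stable_fst.sn M h
  | bot => exact h

theorem MType.pair_mem_sem {A B : MType α} {P Q : Term} (hP : P ∈ A.sem.1) (hQ : Q ∈ B.sem.1) :
    Term.pair P Q ∈ (MType.and A B).sem.1 := by
  rw [MType.sem, fixPair_fst]
  exact .inl (.inr ⟨P, hP, Q, hQ, rfl⟩)

theorem MType.inj_mem_sem {A B : MType α} {M : Term} (h : M ∈ injSet A.sem.1 B.sem.1) :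
    M ∈ (MType.or A B).sem.1 :=
  .inl (.inr h)

/-- Adequacy. Arbitrary reducible substitutions are needed so that, under a binder, `s` can be
extended by any `Q` in the candidate. -/
theorem HasType.subst_mem_sem {Γ : List (MType α)} {M : Term} {C : Ty α} (h : HasType Γ M C)
    (s : ℕ → Term) (hs : ∀ n A, Γ[n]? = some A → s n ∈ A.sem.1) : M.subst s ∈ C.sem := by
  induction h generalizing s with
  | var h => exact hs _ _ h
  | pair _ _ ih₁ ih₂ => exact MType.pair_mem_sem (ih₁ s hs) (ih₂ s hs)
  | inj₁ _ ih => exact MType.inj_mem_sem (.inl ⟨_, ih s hs, rfl⟩)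
  | inj₂ _ ih => exact MType.inj_mem_sem (.inr ⟨_, ih s hs, rfl⟩)
  | @lam Γ P A _ ih =>
    rw [Ty.sem, MType.sem_neg]
    refine A.candidates_sem.lam_snd ⟨_, rfl, fun Q hQ => ?_⟩
    rw [inst_subst_up]
    refine ih _ fun n B hn => ?_
    cases n with
    | zero =>
      cases hn
      exact hQ
    | succ n => exact hs n B hn
  | @star Γ P Q A _ _ ih₁ ih₂ =>
    have h₁ := ih₁ s hs
    rw [Ty.sem, MType.sem_neg] at h₁
    exact (A.candidates_sem.orthogonal _ (ih₂ s hs) _ h₁).2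

theorem HasType.sn {Γ : List (MType α)} {M : Term} {C : Ty α} (h : HasType Γ M C) : SN M := by
  have := h.subst_mem_sem Term.var fun n A _ => A.candidates_sem.var_fst n
  rw [subst_var] at this
  exact Ty.sn_of_mem_sem this

end LambdaSym

theorem mainTheorem1 {α : Type*} (Γ : List (LambdaSym.MType α)) (M : LambdaSym.Term)
    (C : LambdaSym.Ty α) (hM : LambdaSym.HasType Γ M C) :
    LambdaSym.StronglyNormalizable M :=
  hM.sn.stronglyNormalizable
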